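/- Let $c,n,m$ be positive integers. There exists a positive integer $C=C(c,n,m)$, depending only on $c$, $n$ and $m$, with the following property. Let $K$ be any field of characteristic zero containing all roots of unity (that is, $K$ contains a primitive $k$-th root of unity for every $k\ge 1$), and let $G$ be any finite subgroup of the semilinear group $\mathrm{GL}(n,K)\rtimes\operatorname{Aut}K$, where $\operatorname{Aut}K$ is the group of all field automorphisms of $K$, acting on $\mathrm{GL}(n,K)$ entrywise. Suppose that - every subgroup of $G$ can be generated by at most $m$ elements, and - the image $\Gamma$ of $G$ under the projection $\mathrm{GL}(n,K)\rtimes\operatorname{Aut}K\to\operatorname{Aut}K$ is nilpotent of class at most $c$, and every element of $\Gamma$ fixes every root of unity in $K$. Then $G$ contains a nilpotent subgroup $H\le G$ of nilpotency class at most $c+1$ and of index $|G:H|\le C$. -/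

import Mathlib

open scoped MatrixGroups

/-- The action of `Aut K` on `GL(n, K)` by applying a field automorphism to every matrix entry. -/
def entrywiseAction (n : ℕ) (K : Type*) [Field K] : RingAut K →* MulAut (GL (Fin n) K) where
  toFun σ := Units.mapEquiv (RingEquiv.mapMatrix (m := Fin n) σ).toMulEquiv
  map_one' := by ext A i j; rfl
  map_mul' σ τ := by ext A i j; rfl

theorem entrywiseAction_apply (n : ℕ) (K : Type*) [Field K] (σ : RingAut K)
    (A : GL (Fin n) K) (i j : Fin n) :
    (entrywiseAction n K σ A : Matrix (Fin n) (Fin n) K) i j = σ (A i j) := rfl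

/-- The semilinear group `ΓL(n, K) = GL(n, K) ⋊ Aut K`, where `Aut K` is the group of all field
automorphisms of `K`, acting on matrices entrywise. The pair `(A, σ)` is the
`σ`-semilinear bijection `v ↦ A (σ v)` of `K ^ n`. -/
abbrev SemilinearGroup (n : ℕ) (K : Type*) [Field K] : Type _ :=
  GL (Fin n) K ⋊[entrywiseAction n K] RingAut K

/-- The projection `ΓL(n, K) → Aut K`. -/
def SemilinearGroup.toAut (n : ℕ) (K : Type*) [Field K] : SemilinearGroup n K →* RingAut K :=
  SemidirectProduct.rightHom

/-- `K` contains all roots of unity: for every `k ≥ 1` it contains a primitive `k`-th one. -/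
def ContainsAllRootsOfUnity (K : Type*) [Field K] : Prop :=
  ∀ k : ℕ, 0 < k → ∃ ζ : K, IsPrimitiveRoot ζ k

/-- The subgroup `Γ` of `Aut K` fixes every root of unity of `K`. -/
def FixesRootsOfUnity {K : Type*} [Field K] (Γ : Subgroup (RingAut K)) : Prop :=
  ∀ σ ∈ Γ, ∀ ζ : K, ∀ k : ℕ, 0 < k → ζ ^ k = 1 → σ ζ = ζ

/-- Every subgroup of `G` can be generated by (at most) `m` elements. -/
def EverySubgroupGeneratedBy (G : Type*) [Group G] (m : ℕ) : Prop :=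
  ∀ H : Subgroup G, ∃ S : Finset G, S.card ≤ m ∧ Subgroup.closure (S : Set G) = H

/-- `G` is nilpotent of class at most `c`. -/
def IsNilpotentOfClassAtMost (G : Type*) [Group G] (c : ℕ) : Prop :=
  Group.IsNilpotent G ∧ Group.nilpotencyClass G ≤ c

open Equiv (Perm)
open scoped commutatorElement

/-! Let `N` be the kernel of `G → Aut K`, a finite linear group. By Jordan's theorem `N` has an
abelian subgroup of bounded index; intersecting the kernels of all homomorphisms from `N` to a fixed
symmetric group makes it characteristic, hence normal in `G`. The index stays bounded because an
`m`-generated group has boundedly many such homomorphisms. Call the result `A`.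

`A` is simultaneously diagonalizable with at most `n` joint eigenspaces. The eigenvalues are roots
of unity, which `G` fixes, so conjugation by `G` permutes the eigenvalue systems even though `G`
acts only semilinearly. An element's effect on these systems determines how it conjugates `A`, so
the centralizer `C` of `A` has index at most `n ^ n` (`index_centralizer_le_of_fixesRootsOfUnity`).

Now `C ⧸ A` is an extension of a group of class at most `c` by a group of bounded order. Two passes
to intersections of kernels remove the bounded part, leaving class `c`; pulling back along the
central subgroup `A` of `C` costs one more class (`exists_subgroup_of_abelian_normal`). -/

theorem isNilpotentOfClassAtMost_iff {G : Type*} [Group G] {c : ℕ} :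
    IsNilpotentOfClassAtMost G c ↔ (⊤ : Subgroup G).lowerCentralSeries c = ⊥ := by
  constructor
  · rintro ⟨h, hc⟩
    exact Subgroup.lowerCentralSeries_eq_bot_iff_nilpotencyClass_le.2 hc
  · intro h
    have : Group.IsNilpotent G := Subgroup.nilpotent_iff_lowerCentralSeries.2 ⟨c, h⟩
    exact ⟨this, Subgroup.lowerCentralSeries_eq_bot_iff_nilpotencyClass_le.1 h⟩

theorem isNilpotentOfClassAtMost_subgroup_iff {G : Type*} [Group G] {H : Subgroup G} {c : ℕ} :
    IsNilpotentOfClassAtMost H c ↔ H.lowerCentralSeries c = ⊥ := by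
  rw [isNilpotentOfClassAtMost_iff, ← Subgroup.top_subtype_lowerCentralSeries H,
    Subgroup.map_eq_bot_iff_of_injective _ H.subtype_injective]

/-! ### Bounded generation and characteristic subgroups of bounded index. -/

namespace EverySubgroupGeneratedBy

variable {G : Type*} [Group G] {m : ℕ}

theorem subgroup (h : EverySubgroupGeneratedBy G m) (H : Subgroup G) :
    EverySubgroupGeneratedBy H m := by
  classical
  intro L
  obtain ⟨S, hS, hcl⟩ := h (L.map H.subtype)
  have hSH : ∀ x ∈ S, x ∈ H := fun x hx => by
    have : x ∈ L.map H.subtype := hcl ▸ Subgroup.subset_closure hx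
    obtain ⟨y, -, rfl⟩ := this
    exact y.2
  refine ⟨S.subtype (· ∈ H), (Finset.card_subtype _ _).trans_le
    ((Finset.card_filter_le _ _).trans hS), ?_⟩
  apply Subgroup.map_injective H.subtype_injective
  rw [← hcl, MonoidHom.map_closure]
  congr 1
  ext x
  simp only [Set.mem_image, Finset.mem_coe, Finset.mem_subtype]
  exact ⟨by rintro ⟨y, hy, rfl⟩; exact hy, fun hx => ⟨⟨x, hSH x hx⟩, hx, rfl⟩⟩

theorem of_surjective {G' : Type*} [Group G'] (h : EverySubgroupGeneratedBy G m) {f : G →* G'}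
    (hf : Function.Surjective f) : EverySubgroupGeneratedBy G' m := by
  classical
  intro L
  obtain ⟨S, hS, hcl⟩ := h (L.comap f)
  refine ⟨S.image f, Finset.card_image_le.trans hS, ?_⟩
  rw [Finset.coe_image, ← MonoidHom.map_closure, hcl, Subgroup.map_comap_eq_self_of_surjective hf]

theorem finite_monoidHom (h : EverySubgroupGeneratedBy G m) (T : Type*) [Group T] [Finite T] :
    Finite (G →* T) ∧ Nat.card (G →* T) ≤ Nat.card T ^ m := by
  obtain ⟨S, hS, hcl⟩ := h ⊤
  have hinj : Function.Injective (fun (f : G →* T) (s : S) => f s) := fun f g hfg =>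
    MonoidHom.eq_of_eqOn_dense hcl fun x hx => congrFun hfg ⟨x, hx⟩
  refine ⟨Finite.of_injective _ hinj, (Nat.card_le_card_of_injective _ hinj).trans ?_⟩
  rw [Nat.card_fun, Nat.card_eq_fintype_card (α := S), Fintype.card_coe]
  exact Nat.pow_le_pow_right Nat.card_pos hS

end EverySubgroupGeneratedBy

/-- The intersection of the kernels of all homomorphisms from `G` to `T`. -/
def homKernel (G T : Type*) [Group G] [Group T] : Subgroup G := ⨅ f : G →* T, f.ker

section homKernel

variable {G T : Type*} [Group G] [Group T]

theorem homKernel_le_ker {T' : Type*} [Group T'] (f : G →* T') {i : T' →* T}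
    (hi : Function.Injective i) : homKernel G T ≤ f.ker := fun x hx => by
  have : i (f x) = 1 := (Subgroup.mem_iInf.1 hx) (i.comp f)
  exact (map_eq_one_iff i hi).1 this

instance homKernel_characteristic : (homKernel G T).Characteristic := by
  refine Subgroup.characteristic_iff_le_comap.2 fun φ x hx => ?_
  exact Subgroup.mem_iInf.2 fun f => Subgroup.mem_iInf.1 hx (f.comp φ.toMonoidHom)

/-- A homomorphism is determined by its values on `m` generators, so at most `|T| ^ m` kernels are
intersected, each of index at most `|T|`. -/
theorem index_homKernel_le [Finite T] {m : ℕ} (h : EverySubgroupGeneratedBy G m) :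
    (homKernel G T).index ≤ Nat.card T ^ (Nat.card T ^ m) := by
  obtain ⟨hfin, hcard⟩ := h.finite_monoidHom T
  have := Fintype.ofFinite (G →* T)
  refine (Subgroup.index_iInf_le _).trans ?_
  refine (Finset.prod_le_pow_card _ _ (Nat.card T) fun f _ => ?_).trans ?_
  · rw [Subgroup.index_ker]
    exact Subgroup.card_le_card_group _
  · rw [Finset.card_univ, ← Nat.card_eq_fintype_card]
    exact Nat.pow_le_pow_right Nat.card_pos hcard

end homKernel

theorem exists_injective_perm_fin (X : Type*) [Finite X] {J : ℕ} (h : Nat.card X ≤ J) :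
    ∃ i : Perm X →* Perm (Fin J), Function.Injective i := by
  have e : X ↪ Fin J := (Finite.equivFin X).toEmbedding.trans (Fin.castLEEmb h)
  exact ⟨Perm.viaEmbeddingHom e, Perm.viaEmbeddingHom_injective e⟩

/-- The action on the cosets of `A` is a homomorphism to a symmetric group whose kernel is the
normal core of `A`. -/
theorem homKernel_perm_le_of_index_le {G : Type*} [Group G] {J : ℕ} (A : Subgroup G)
    [A.FiniteIndex] (h : A.index ≤ J) : homKernel G (Perm (Fin J)) ≤ A := by
  obtain ⟨i, hi⟩ := exists_injective_perm_fin (G ⧸ A) (h : Nat.card (G ⧸ A) ≤ J)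
  refine (homKernel_le_ker (MulAction.toPermHom G (G ⧸ A)) hi).trans ?_
  rw [← Subgroup.normalCore_eq_ker]
  exact A.normalCore_le

theorem homKernel_perm_le_centralizer {G : Type*} [Group G] {J : ℕ} (F : Subgroup G) [F.Normal]
    [Finite F] (h : Nat.card F ≤ J) :
    homKernel G (Perm (Fin J)) ≤ Subgroup.centralizer (F : Set G) := by
  obtain ⟨i, hi⟩ := exists_injective_perm_fin F h
  have := homKernel_le_ker ((MulAut.toPerm F).comp (MulAut.conjNormal (H := F))) hi
  intro x hx y hy
  have h1 : MulAut.toPerm F (MulAut.conjNormal x) ⟨y, hy⟩ = (1 : Perm F) ⟨y, hy⟩ :=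
    congrArg (· ⟨y, hy⟩) (this hx)
  have h2 : x * y * x⁻¹ = y := congrArg Subtype.val h1
  exact (mul_inv_eq_iff_eq_mul.1 h2).symm

/-- If the commutators of all elements of `G` with `y` are central and lie in a subgroup `F` of
order at most `J`, then every element of `homKernel G (Perm (Fin J))` commutes with `y`. -/
theorem commute_of_mem_homKernel_perm {G : Type*} [Group G] {J : ℕ} (F : Subgroup G)
    (hF : F ≤ Subgroup.center G) [Finite F] (h : Nat.card F ≤ J) {y : G} (hy : ∀ x : G, ⁅x, y⁆ ∈ F)
    {x : G} (hx : x ∈ homKernel G (Perm (Fin J))) : Commute x y := by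
  obtain ⟨i, hi⟩ := exists_injective_perm_fin F h
  -- Centrality of the commutators makes `x ↦ ⁅x, y⁆` multiplicative; `F` then embeds in a symmetric
  -- group by its regular action.
  let f : G →* F := MonoidHom.mk' (fun x => ⟨⁅x, y⁆, hy x⟩) fun a b => by
    ext
    have hb := Subgroup.mem_center_iff.1 (hF (hy b)) a
    simp only [Subgroup.coe_mul]
    calc ⁅a * b, y⁆ = a * ⁅b, y⁆ * (y * a⁻¹ * y⁻¹) := by simp only [commutatorElement_def]; group
      _ = ⁅b, y⁆ * ⁅a, y⁆ := by rw [hb]; simp only [commutatorElement_def]; group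
      _ = ⁅a, y⁆ * ⁅b, y⁆ := (Subgroup.mem_center_iff.1 (hF (hy b)) _).symm
  have h1 := homKernel_le_ker f (i := i.comp (MulAction.toPermHom F F))
    (hi.comp MulAction.toPerm_injective) hx
  exact commutatorElement_eq_one_iff_commute.1 (congrArg Subtype.val (MonoidHom.mem_ker.1 h1))

/-- The bound `t ^ (t ^ m)` with `t = J!` for the index of `homKernel G (Perm (Fin J))`. -/
def homKernelBound (J m : ℕ) : ℕ := J.factorial ^ (J.factorial ^ m)

theorem homKernelBound_pos (J m : ℕ) : 0 < homKernelBound J m :=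
  pow_pos J.factorial_pos _

theorem index_homKernel_perm_le {G : Type*} [Group G] {m : ℕ} (h : EverySubgroupGeneratedBy G m)
    (J : ℕ) : (homKernel G (Perm (Fin J))).index ≤ homKernelBound J m := by
  have := index_homKernel_le (T := Perm (Fin J)) h
  rwa [Nat.card_perm, Nat.card_fin] at this

/-- If the quotient of `G` by a central subgroup `F` of order at most `J` has class at most `c + 1`,
then `homKernel G (Perm (Fin J))` has class at most `c + 1`. -/
theorem lowerCentralSeries_homKernel_eq_bot {G : Type*} [Group G] {J c : ℕ} (F : Subgroup G)
    (hF : F ≤ Subgroup.center G) [Finite F] (h : Nat.card F ≤ J)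
    (hc : (⊤ : Subgroup G).lowerCentralSeries (c + 1) ≤ F) :
    (homKernel G (Perm (Fin J))).lowerCentralSeries (c + 1) = ⊥ := by
  rw [Subgroup.lowerCentralSeries_succ, eq_bot_iff, Subgroup.commutator_le]
  intro y hy x hx
  have hy' := Subgroup.lowerCentralSeries_mono c (le_top (a := homKernel G (Perm (Fin J)))) hy
  refine Subgroup.mem_bot.2 (commutatorElement_eq_one_iff_commute.2
    (commute_of_mem_homKernel_perm F hF h (fun z => ?_) hx).symm)
  rw [← commutatorElement_inv]
  exact inv_mem (hc (Subgroup.commutator_mem_commutator hy' (Subgroup.mem_top z)))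

/-- A group all of whose subgroups are `m`-generated, and which is an extension of a group of class
at most `c` by a group of order at most `J`, has a subgroup of class at most `c` and of bounded
index. -/
theorem exists_subgroup_lowerCentralSeries_eq_bot {G : Type*} [Group G] {J c m : ℕ} (hc : 0 < c)
    (hm : EverySubgroupGeneratedBy G m) (F : Subgroup G) [F.Normal] [Finite F]
    (h : Nat.card F ≤ J) (hF : (⊤ : Subgroup G).lowerCentralSeries c ≤ F) :
    ∃ H : Subgroup G, H.lowerCentralSeries c = ⊥ ∧ H.index ≤ homKernelBound J m ^ 2 := by
  obtain ⟨c, rfl⟩ := Nat.exists_eq_succ_of_ne_zero hc.ne'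
  let D := homKernel G (Perm (Fin J))
  have hDF : D ≤ Subgroup.centralizer (F : Set G) := homKernel_perm_le_centralizer F h
  have hcentral : F.subgroupOf D ≤ Subgroup.center D := fun x hx =>
    Subgroup.mem_center_iff.2 fun y => Subtype.ext
      ((Subgroup.mem_centralizer_iff.1 (hDF y.2)) x (Subgroup.mem_subgroupOf.1 hx)).symm
  have hinj : Function.Injective fun x : F.subgroupOf D =>
      (⟨x, Subgroup.mem_subgroupOf.1 x.2⟩ : F) := fun x y hxy =>
    Subtype.ext (Subtype.ext (congrArg (Subtype.val : F → G) hxy))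
  have : Finite (F.subgroupOf D) := Finite.of_injective _ hinj
  have hcard : Nat.card (F.subgroupOf D) ≤ J := (Nat.card_le_card_of_injective _ hinj).trans h
  have hlcs : (⊤ : Subgroup D).lowerCentralSeries (c + 1) ≤ F.subgroupOf D := by
    rw [Subgroup.subgroupOf, ← Subgroup.map_le_iff_le_comap,
      Subgroup.top_subtype_lowerCentralSeries]
    exact (Subgroup.lowerCentralSeries_mono _ le_top).trans hF
  -- The first pass `D` makes `F` central; the second, inside `D`, kills the last commutators. Hence
  -- the square in the bound.
  refine ⟨(homKernel D (Perm (Fin J))).map D.subtype, ?_, ?_⟩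
  · rw [← Subgroup.map_lowerCentralSeries,
      lowerCentralSeries_homKernel_eq_bot _ hcentral hcard hlcs, Subgroup.map_bot]
  · rw [Subgroup.index_map_subtype, sq]
    exact Nat.mul_le_mul (index_homKernel_perm_le (hm.subgroup D) J) (index_homKernel_perm_le hm J)

/-- The purely group theoretic part of the main theorem: `A` and `N` are normal subgroups
of `G` such that `A` has bounded index in `N` and its centralizer has bounded index in `G`, and
`G ⧸ N` has class at most `c`. -/
theorem exists_subgroup_of_abelian_normal {G : Type*} [Group G] [Finite G] {J B c m : ℕ}
    (hc : 0 < c) (hm : EverySubgroupGeneratedBy G m) (A N : Subgroup G) [A.Normal] [N.Normal]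
    (hAN : A.relIndex N ≤ J)
    (hB : (Subgroup.centralizer (A : Set G)).index ≤ B)
    (hN : (⊤ : Subgroup G).lowerCentralSeries c ≤ N) :
    ∃ H : Subgroup G, H.lowerCentralSeries (c + 1) = ⊥ ∧ H.index ≤ homKernelBound J m ^ 2 * B := by
  let C := Subgroup.centralizer (A : Set G)
  let A' := A.subgroupOf C
  let q := QuotientGroup.mk' A'
  have hq : Function.Surjective q := QuotientGroup.mk'_surjective A'
  let F := (N.subgroupOf C).map q
  have : F.Normal := Subgroup.Normal.map inferInstance _ hq
  have hcard : Nat.card F ≤ J := by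
    rw [← Subgroup.relIndex_ker, QuotientGroup.ker_mk']
    change (A.comap C.subtype).relIndex _ ≤ J
    rw [Subgroup.relIndex_comap]
    refine (Subgroup.relIndex_le_of_le_right (Subgroup.map_comap_le _ _) ?_).trans hAN
    exact Subgroup.FiniteIndex.index_ne_zero
  have hlcs : (⊤ : Subgroup (C ⧸ A')).lowerCentralSeries c ≤ F := by
    rw [← Subgroup.map_top_of_surjective q hq, ← Subgroup.map_lowerCentralSeries]
    refine Subgroup.map_mono ?_
    rw [Subgroup.subgroupOf, ← Subgroup.map_le_iff_le_comap,
      Subgroup.top_subtype_lowerCentralSeries]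
    exact (Subgroup.lowerCentralSeries_mono _ le_top).trans hN
  obtain ⟨H, hH, hHi⟩ := exists_subgroup_lowerCentralSeries_eq_bot hc
    ((hm.subgroup C).of_surjective hq) F hcard hlcs
  have hcentral : A' ≤ Subgroup.center C := fun x hx =>
    Subgroup.mem_center_iff.2 fun y => Subtype.ext
      ((Subgroup.mem_centralizer_iff.1 y.2) x (Subgroup.mem_subgroupOf.1 hx)).symm
  refine ⟨(H.comap q).map C.subtype, ?_, ?_⟩
  -- The `c`-th term of the series of the preimage of `H` lies in `A'`, which is central in `C`.
  · rw [← Subgroup.map_lowerCentralSeries, Subgroup.lowerCentralSeries_succ_eq_bot,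
      Subgroup.map_bot]
    refine le_trans ?_ ((QuotientGroup.ker_mk' A').le.trans hcentral)
    rw [← Subgroup.map_eq_bot_iff, Subgroup.map_lowerCentralSeries,
      Subgroup.map_comap_eq_self_of_surjective hq, hH]
  · rw [Subgroup.index_map_subtype, Subgroup.index_comap_of_surjective _ hq]
    exact Nat.mul_le_mul hHi hB

/-! ### Simultaneous diagonalization of commuting endomorphisms of finite order. -/

section Diagonalization

open Module End

variable {K V : Type*} [Field K] [AddCommGroup V] [Module K V]

theorem isSemisimple_of_pow_eq_one [CharZero K] {f : End K V} {k : ℕ} (hk : 0 < k)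
    (hf : f ^ k = 1) : f.IsSemisimple := by
  refine isSemisimple_of_squarefree_aeval_eq_zero (p := Polynomial.X ^ k - Polynomial.C 1) ?_ ?_
  · exact (Polynomial.separable_X_pow_sub_C 1 (Nat.cast_ne_zero.2 hk.ne') one_ne_zero).squarefree
  · simp [hf]

theorem ker_aeval_prod_X_sub_C_le_iSup_eigenspace (f : End K V) (s : Finset K) :
    LinearMap.ker (Polynomial.aeval f (∏ μ ∈ s, (Polynomial.X - Polynomial.C μ))) ≤
      ⨆ μ, f.eigenspace μ := by
  classical
  induction s using Finset.induction_on with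
  | empty => simp [Module.End.one_eq_id]
  | insert μ s hμ ih =>
    rw [Finset.prod_insert hμ, ← Polynomial.sup_ker_aeval_eq_ker_aeval_mul_of_coprime]
    · refine sup_le (le_trans ?_ (le_iSup _ μ)) ih
      rw [eigenspace_def]
      simp [Algebra.algebraMap_eq_smul_one]
    · exact IsCoprime.prod_right fun ν hν =>
        Polynomial.isCoprime_X_sub_C_of_isUnit_sub (sub_ne_zero.2 (by rintro rfl; exact hμ hν)).isUnit

theorem iSup_eigenspace_eq_top_of_pow_eq_one {f : End K V} {k : ℕ} (hk : 0 < k) (hf : f ^ k = 1)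
    {ζ : K} (hζ : IsPrimitiveRoot ζ k) : ⨆ μ, f.eigenspace μ = ⊤ := by
  rw [eq_top_iff]
  refine le_trans ?_
    (ker_aeval_prod_X_sub_C_le_iSup_eigenspace f (Polynomial.nthRootsFinset k (1 : K)))
  rw [← Polynomial.X_pow_sub_one_eq_prod hk hζ]
  simp [hf]

/-- The simultaneous eigenspace of the family `f` for the system of eigenvalues `χ`. -/
def jointEigenspace {ι : Type*} (f : ι → End K V) (χ : ι → K) : Submodule K V :=
  ⨅ i, (f i).eigenspace (χ i)

theorem mem_jointEigenspace {ι : Type*} {f : ι → End K V} {χ : ι → K} {v : V} :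
    v ∈ jointEigenspace f χ ↔ ∀ i, f i v = χ i • v := by
  simp [jointEigenspace]

variable [CharZero K] [FiniteDimensional K V] {ι : Type*} {f : ι → End K V} {k : ℕ}

omit [FiniteDimensional K V] in
theorem jointEigenspace_eq_iInf_maxGenEigenspace (hk : 0 < k) (hf : ∀ i, f i ^ k = 1) :
    jointEigenspace f = fun χ => ⨅ i, (f i).maxGenEigenspace (χ i) := by
  ext1 χ
  exact iInf_congr fun i =>
    ((isSemisimple_of_pow_eq_one hk (hf i)).isFinitelySemisimple.maxGenEigenspace_eq_eigenspace
    _).symm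

theorem iSup_jointEigenspace_eq_top (hk : 0 < k) (hf : ∀ i, f i ^ k = 1)
    (hcomm : ∀ i j, Commute (f i) (f j)) {ζ : K} (hζ : IsPrimitiveRoot ζ k) :
    ⨆ χ, jointEigenspace f χ = ⊤ := by
  rw [jointEigenspace_eq_iInf_maxGenEigenspace hk hf]
  refine iSup_iInf_maxGenEigenspace_eq_top_of_iSup_maxGenEigenspace_eq_top_of_commute f
    (fun i j _ => hcomm i j) fun i => ?_
  rw [(isSemisimple_of_pow_eq_one hk (hf i)).iSup_maxGenEigenspace_eq_top_iff]
  exact iSup_eigenspace_eq_top_of_pow_eq_one hk (hf i) hζ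

theorem finite_setOf_jointEigenspace_ne_bot (hk : 0 < k) (hf : ∀ i, f i ^ k = 1)
    (hcomm : ∀ i j, Commute (f i) (f j)) :
    Finite {χ // jointEigenspace f χ ≠ ⊥} ∧
      Nat.card {χ // jointEigenspace f χ ≠ ⊥} ≤ finrank K V := by
  have h : iSupIndep (jointEigenspace f) := by
    rw [jointEigenspace_eq_iInf_maxGenEigenspace hk hf]
    exact independent_iInf_maxGenEigenspace_of_forall_mapsTo f fun i j φ =>
      mapsTo_maxGenEigenspace_of_comm (hcomm j i) φ
  have := h.fintypeNeBotOfFiniteDimensional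
  exact ⟨inferInstance, Nat.card_eq_fintype_card.trans_le h.subtype_ne_bot_le_finrank⟩

end Diagonalization

/-! ### The semilinear action and the centralizer of an abelian normal subgroup. -/

namespace SemilinearGroup

variable {n : ℕ} {K : Type*} [Field K]

/-- The semilinear action of `ΓL(n, K)` on `K ^ n`. -/
def act (g : SemilinearGroup n K) (v : Fin n → K) : Fin n → K :=
  (g.left : Matrix (Fin n) (Fin n) K).mulVec fun i => g.right (v i)

theorem act_mul (g h : SemilinearGroup n K) (v : Fin n → K) :
    (g * h).act v = g.act (h.act v) := by
  simp only [act, SemidirectProduct.mul_left, SemidirectProduct.mul_right, Units.val_mul,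
    ← Matrix.mulVec_mulVec]
  congr 1
  ext i
  simp [Matrix.mulVec, dotProduct, entrywiseAction_apply, RingAut.mul_apply]

theorem act_smul (g : SemilinearGroup n K) (c : K) (v : Fin n → K) :
    g.act (c • v) = g.right c • g.act v := by
  simp only [act, ← Matrix.mulVec_smul]
  congr 1
  ext i
  simp

theorem act_ne_zero (g : SemilinearGroup n K) {v : Fin n → K} (hv : v ≠ 0) : g.act v ≠ 0 := by
  intro h
  apply hv
  have h1 : (g⁻¹ * g).act v = g⁻¹.act 0 := by rw [act_mul, h]
  simpa [act, funext_iff, Matrix.mulVec, dotProduct] using h1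

/-- The matrix part of an element of the semilinear group as a linear endomorphism of `K ^ n`. -/
def toEnd (g : SemilinearGroup n K) : Module.End K (Fin n → K) :=
  Matrix.toLin' (g.left : Matrix (Fin n) (Fin n) K)

theorem act_eq_toEnd {g : SemilinearGroup n K} (hg : g.right = 1) (v : Fin n → K) :
    g.act v = g.toEnd v := by
  simp [act, toEnd, hg, RingAut.one_apply]

theorem toEnd_mul {g : SemilinearGroup n K} (hg : g.right = 1) (h : SemilinearGroup n K) :
    (g * h).toEnd = g.toEnd * h.toEnd := by
  simp [toEnd, hg, Matrix.toLin'_mul, Module.End.mul_eq_comp]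

theorem eq_of_toEnd_eq {g h : SemilinearGroup n K} (hg : g.right = 1) (hh : h.right = 1)
    (he : g.toEnd = h.toEnd) : g = h :=
  SemidirectProduct.ext (Units.ext (Matrix.toLin'.injective he)) (hg.trans hh.symm)

theorem toEnd_pow {g : SemilinearGroup n K} (hg : g.right = 1) (k : ℕ) :
    (g ^ k).toEnd = g.toEnd ^ k := by
  induction k with
  | zero => simp [toEnd, Module.End.one_eq_id]
  | succ k ih => rw [pow_succ', pow_succ', toEnd_mul hg, ih]

end SemilinearGroup

theorem index_centralizer_le_of_fixesRootsOfUnity {n : ℕ} (hn : 0 < n) {K : Type*} [Field K]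
    [CharZero K] (hK : ContainsAllRootsOfUnity K) (G : Subgroup (SemilinearGroup n K)) [Finite G]
    (hG : ∀ g ∈ G, ∀ ζ : K, ∀ k : ℕ, 0 < k → ζ ^ k = 1 → g.right ζ = ζ)
    (A : Subgroup G) [A.Normal] (hcomm : ∀ a ∈ A, ∀ b ∈ A, Commute a b)
    (hA : ∀ a ∈ A, a.1.right = 1) :
    (Subgroup.centralizer (A : Set G)).index ≤ n ^ n := by
  let f : A → Module.End K (Fin n → K) := fun a => a.1.1.toEnd
  have hk : 0 < Nat.card G := Nat.card_pos
  have hf : ∀ a, f a ^ Nat.card G = 1 := fun a => by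
    rw [← SemilinearGroup.toEnd_pow (hA a a.2), ← Subgroup.coe_pow, pow_card_eq_one']
    simp [SemilinearGroup.toEnd, Module.End.one_eq_id]
  have hfc : ∀ a b, Commute (f a) (f b) := fun a b => by
    rw [Commute, SemiconjBy, ← SemilinearGroup.toEnd_mul (hA a a.2),
      ← SemilinearGroup.toEnd_mul (hA b b.2)]
    exact congrArg (fun x : G => x.1.toEnd) (hcomm a a.2 b b.2).eq
  obtain ⟨ζ, hζ⟩ := hK _ hk
  have htop := iSup_jointEigenspace_eq_top hk hf hfc hζ
  obtain ⟨hfin, hcard⟩ := finite_setOf_jointEigenspace_ne_bot hk hf hfc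
  rw [Module.finrank_fin_fun] at hcard
  have hroot : ∀ χ, jointEigenspace f χ ≠ ⊥ → ∀ g : G, ∀ a, g.1.right (χ a) = χ a := by
    intro χ hχ g a
    obtain ⟨v, hv, hv0⟩ := Submodule.exists_mem_ne_zero_of_ne_bot hχ
    refine hG g g.2 _ _ hk ?_
    have h1 : ∀ j : ℕ, (f a ^ j) v = χ a ^ j • v := fun j => by
      induction j with
      | zero => simp
      | succ j ih =>
        rw [pow_succ', Module.End.mul_apply, ih, map_smul, mem_jointEigenspace.1 hv, smul_smul,
          pow_succ]
    have h2 := h1 (Nat.card G)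
    rw [hf, Module.End.one_apply] at h2
    have h3 : (χ a ^ Nat.card G - 1) • v = 0 := by rw [sub_smul, ← h2, one_smul, sub_self]
    exact sub_eq_zero.1 ((smul_eq_zero.1 h3).resolve_right hv0)
  have hconj : ∀ g : G, ∀ χ, jointEigenspace f χ ≠ ⊥ →
      jointEigenspace f (fun a => χ (MulAut.conjNormal g a)) ≠ ⊥ := by
    intro g χ hχ
    obtain ⟨v, hv, hv0⟩ := Submodule.exists_mem_ne_zero_of_ne_bot hχ
    -- `g⁻¹` carries an eigenvector for `χ` to one for the conjugated system: moving the scalar past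
    -- `g⁻¹` applies a field automorphism, which fixes the root of unity `χ a`.
    refine Submodule.ne_bot_iff _ |>.2 ⟨(g⁻¹ : G).1.act v, mem_jointEigenspace.2 fun a => ?_,
      SemilinearGroup.act_ne_zero _ hv0⟩
    have h1 : a.1 * g⁻¹ = g⁻¹ * (MulAut.conjNormal g a : A).1 := by
      rw [MulAut.conjNormal_apply]; group
    have h2 := mem_jointEigenspace.1 hv (MulAut.conjNormal g a)
    simp only [f] at h2 ⊢
    rw [← SemilinearGroup.act_eq_toEnd (hA _ (Subtype.prop _))] at h2 ⊢
    rw [← SemilinearGroup.act_mul, ← Subgroup.coe_mul, h1, Subgroup.coe_mul,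
      SemilinearGroup.act_mul, h2, SemilinearGroup.act_smul, hroot χ hχ]
  let W := {χ // jointEigenspace f χ ≠ ⊥}
  -- Only the number of self-maps of `W` is counted, whence `n ^ n`.
  let Φ : G → W → W := fun g χ => ⟨_, hconj g χ.1 χ.2⟩
  have hΦ : ∀ g h : G, Φ g = Φ h → g⁻¹ * h ∈ Subgroup.centralizer (A : Set G) := by
    intro g h hgh a ha
    -- Both conjugates of `a` have the same eigenvalue on each joint eigenspace, and these span.
    have key : f (MulAut.conjNormal g ⟨a, ha⟩) = f (MulAut.conjNormal h ⟨a, ha⟩) := by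
      have hle : ⨆ χ, jointEigenspace f χ ≤ LinearMap.eqLocus (f (MulAut.conjNormal g ⟨a, ha⟩))
          (f (MulAut.conjNormal h ⟨a, ha⟩)) := by
        refine iSup_le fun χ v hv => ?_
        by_cases hχ : jointEigenspace f χ = ⊥
        · rw [hχ, Submodule.mem_bot] at hv
          rw [hv]; exact zero_mem _
        · have h1 := congrFun (congrArg Subtype.val (congrFun hgh ⟨χ, hχ⟩)) ⟨a, ha⟩
          rw [LinearMap.mem_eqLocus, mem_jointEigenspace.1 hv, mem_jointEigenspace.1 hv]
          exact congrArg (· • v) h1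
      rw [htop] at hle
      exact LinearMap.ext fun v => hle (Submodule.mem_top (x := v))
    have h2 := Subtype.ext (SemilinearGroup.eq_of_toEnd_eq (hA _ (Subtype.prop _))
      (hA _ (Subtype.prop _)) key)
    rw [MulAut.conjNormal_apply, MulAut.conjNormal_apply] at h2
    have h3 : h = (g * a * g⁻¹) * h * a⁻¹ := by rw [h2]; group
    change a * (g⁻¹ * h) = g⁻¹ * h * a
    conv_rhs => rw [h3]
    group
  have hinj : Function.Injective fun q : G ⧸ Subgroup.centralizer (A : Set G) => Φ q.out := by
    intro q r hqr
    rw [← QuotientGroup.out_eq' q, ← QuotientGroup.out_eq' r]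
    exact QuotientGroup.eq.2 (hΦ _ _ hqr)
  refine (Nat.card_le_card_of_injective _ hinj).trans ?_
  rw [Nat.card_fun]
  exact (Nat.pow_le_pow_left hcard _).trans (Nat.pow_le_pow_right hn hcard)

-- Reduction from characteristic zero to unitary representations.

universe u in
-- Adjoin continuum many variables and close algebraically: the result has the cardinality of `ℂ`,
-- so by Steinitz it is isomorphic to `ℂ`.
theorem nonempty_ringHom_complex (k : Type u) [Field k] [CharZero k] [Countable k] :
    Nonempty (k →+* ℂ) := by
  let L := AlgebraicClosure (FractionRing (MvPolynomial ℝ k))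
  have : CharZero L := charZero_of_injective_algebraMap (FaithfulSMul.algebraMap_injective k L)
  have h1 : Cardinal.mk (FractionRing (MvPolynomial ℝ k)) =
      Cardinal.lift.{u, 0} Cardinal.continuum := by
    rw [Cardinal.mk_fractionRing, MvPolynomial.cardinalMk_eq_max_lift, Cardinal.mk_real]
    apply le_antisymm
    · refine max_le (max_le ((Cardinal.lift_le.2 (Cardinal.mk_le_aleph0 (α := k))).trans ?_) ?_) ?_
      all_goals simp [Cardinal.aleph0_le_continuum]
    · simp
  have h2 : Cardinal.mk L = Cardinal.lift.{u, 0} Cardinal.continuum := by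
    apply le_antisymm
    · refine (Algebra.IsAlgebraic.cardinalMk_le_max (FractionRing (MvPolynomial ℝ k)) L).trans ?_
      rw [h1]
      simp [Cardinal.aleph0_le_continuum]
    · rw [← h1]
      exact Cardinal.mk_le_of_injective (FaithfulSMul.algebraMap_injective _ L)
  have h3 : Nonempty (L ≃ ℂ) := by
    rw [← Cardinal.lift_mk_eq', h2, Cardinal.mk_complex]
    simp
  obtain ⟨e⟩ := IsAlgClosed.ringEquiv_of_equiv_of_charZero
    (by rw [h2]; simp [Cardinal.aleph0_lt_continuum]) h3
  exact ⟨e.toRingHom.comp (algebraMap k L)⟩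

/-- The finitely many matrix entries generate a countable subfield, which embeds in `ℂ`. -/
theorem exists_injective_complex_representation {K : Type*} [Field K] [CharZero K] {n : ℕ}
    {N : Type*} [Group N] [Finite N] (ρ : N →* Matrix (Fin n) (Fin n) K)
    (hρ : Function.Injective ρ) :
    ∃ τ : N →* Matrix (Fin n) (Fin n) ℂ, Function.Injective τ := by
  let s : Set K := Set.range fun x : N × Fin n × Fin n => ρ x.1 x.2.1 x.2.2
  let k := Subfield.closure s
  have : Countable k := by
    rw [← Cardinal.mk_le_aleph0_iff]
    refine (Subfield.cardinalMk_closure_le_max s).trans (max_le ?_ le_rfl)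
    exact Cardinal.mk_le_aleph0_iff.2 (Set.countable_range _)
  obtain ⟨φ⟩ := nonempty_ringHom_complex k
  let ρ' : N →* Matrix (Fin n) (Fin n) k :=
    { toFun g := Matrix.of fun i j => ⟨ρ g i j, Subfield.subset_closure ⟨(g, i, j), rfl⟩⟩
      map_one' := by
        ext i j
        simp [Matrix.one_apply, apply_ite]
      map_mul' g h := by
        ext i j
        simp [Matrix.mul_apply] }
  refine ⟨φ.mapMatrix.toMonoidHom.comp ρ', fun g h hgh => hρ ?_⟩
  ext i j
  exact congrArg Subtype.val (φ.injective (congrFun (congrFun hgh i) j))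

/-- A representation of a finite group in a C⋆-algebra is conjugate to a unitary one. -/
theorem exists_unitary_representation {A : Type*} [CStarAlgebra A] [PartialOrder A]
    [StarOrderedRing A] {N : Type*} [Group N] [Finite N] (ρ : N →* A)
    (hρ : Function.Injective ρ) : ∃ τ : N →* unitary A, Function.Injective τ := by
  classical
  have := Fintype.ofFinite N
  -- The averaged invariant form; writing `M = P⋆ P`, conjugation by `P` makes the representation
  -- unitary.
  let M := ∑ g, star (ρ g) * ρ g
  have hM : IsStrictlyPositive M := by
    simp only [M]
    rw [← Finset.add_sum_erase _ _ (Finset.mem_univ 1), map_one, star_one, mul_one]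
    exact IsStrictlyPositive.add_nonneg isStrictlyPositive_one
      (Finset.sum_nonneg fun g _ => star_mul_self_nonneg _)
  obtain ⟨P, ⟨P, rfl⟩, hP⟩ := CStarAlgebra.isStrictlyPositive_iff_eq_star_mul_self.1 hM
  have hinv : ∀ g, star (ρ g) * M * ρ g = M := fun g => by
    simp only [M, Finset.mul_sum, Finset.sum_mul]
    refine Fintype.sum_equiv (Equiv.mulRight g) _ _ fun h => ?_
    simp [mul_assoc]
  let σ : N →* A :=
    { toFun g := P * ρ g * ↑P⁻¹
      map_one' := by simp
      map_mul' g h := by simp [mul_assoc] }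
  have hstar : ∀ g, star (σ g) * σ g = 1 := fun g => by
    have : star (σ g) * σ g = star (↑P⁻¹ : A) * (star (ρ g) * (star (P : A) * P) * ρ g) * ↑P⁻¹ := by
      simp [σ, mul_assoc]
    rw [this, ← hP, hinv, hP, ← mul_assoc, ← star_mul, mul_assoc]
    simp
  have hmem : ∀ g, σ g ∈ unitary A := fun g => by
    refine Unitary.mem_iff.2 ⟨hstar g, ?_⟩
    have h1 : σ g * σ g⁻¹ = 1 := by rw [← map_mul, mul_inv_cancel, map_one]
    rwa [← left_inv_eq_right_inv (hstar g) h1] at h1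
  refine ⟨σ.codRestrict (unitary A) hmem, fun g h hgh => hρ ?_⟩
  have h1 : (P : A) * ρ g * ↑P⁻¹ = P * ρ h * ↑P⁻¹ := congrArg Subtype.val hgh
  exact P.isUnit.mul_left_cancel (P⁻¹.isUnit.mul_right_cancel h1)

/-! ### Jordan's theorem via commutators of unitaries near the identity. -/

section Jordan

variable {E : Type*} [NormedAddCommGroup E] [InnerProductSpace ℂ E] [FiniteDimensional ℂ E]

omit [FiniteDimensional ℂ E] in
theorem inner_eq_zero_of_unitary_eigenvectors (A : E ≃ₗᵢ[ℂ] E) {a b : ℂ} (hab : a ≠ b) {x y : E}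
    (hx : A x = a • x) (hy : A y = b • y) : inner ℂ x y = 0 := by
  rcases eq_or_ne x 0 with rfl | hx0
  · simp
  have ha : ‖a‖ = 1 := by
    have h := A.norm_map x
    rw [hx, norm_smul] at h
    exact (mul_eq_right₀ (norm_ne_zero_iff.2 hx0)).1 h
  have h := A.inner_map_map x y
  rw [hx, hy, inner_smul_left, inner_smul_right] at h
  by_contra h0
  have h1 : starRingEnd ℂ a * b = 1 := by
    rw [← mul_assoc] at h
    exact (mul_eq_right₀ h0).1 h
  have h2 : a * starRingEnd ℂ a = 1 := by
    rw [Complex.mul_conj, Complex.normSq_eq_norm_sq, ha]; simp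
  exact hab (by linear_combination b * h2 - a * h1)

/-- Frobenius' lemma: if a unitary `A` of finite order commutes with `B A B⁻¹` for a unitary `B`
at distance less than `1` from the identity, then `A` commutes with `B`. -/
theorem commute_of_commute_conj (A B : E ≃ₗᵢ[ℂ] E) {k : ℕ} (hk : 0 < k) (hA : A ^ k = 1)
    (hB : ∀ x, x ≠ 0 → ‖B x - x‖ < ‖x‖) (hAB : Commute A (B * A * B⁻¹)) : Commute A B := by
  let f : Module.End ℂ E := A.toLinearEquiv.toLinearMap
  have hfk : f ^ k = 1 := by
    have h1 : ∀ j : ℕ, ∀ x, (f ^ j) x = (A ^ j) x := fun j => by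
      induction j with
      | zero => simp
      | succ j ih =>
        intro x
        rw [pow_succ', pow_succ', Module.End.mul_apply, ih]
        rfl
    ext x
    rw [h1, hA]
    rfl
  have hss := isSemisimple_of_pow_eq_one hk hfk
  have htop := hss.iSup_eigenspace_eq_top
  have key : ∀ μ : ℂ, ∀ x, A x = μ • x → A (B x) = μ • B x := by
    intro μ x hx
    -- `p` is the image under `B` of the `μ`-eigenspace of `A`, that is, the `μ`-eigenspace of `B A
    -- B⁻¹`; hence it is `A`-invariant.
    let p : Submodule ℂ E := (f.eigenspace μ).comap (B⁻¹).toLinearEquiv.toLinearMap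
    have hp : ∀ y, y ∈ p ↔ A (B⁻¹ y) = μ • B⁻¹ y := fun y => Module.End.mem_eigenspace_iff
    have hinv : p ∈ f.invtSubmodule := by
      intro y hy
      rw [hp] at hy
      refine (hp (A y)).2 ?_
      have h1 : A (B (A (B⁻¹ y))) = B (A (B⁻¹ (A y))) := DFunLike.congr_fun hAB.eq y
      have h2 : B (B⁻¹ y) = y := B.apply_symm_apply y
      rw [hy, map_smul, map_smul, h2] at h1
      apply B.injective
      rw [← h1, map_smul]
      exact congrArg (μ • ·) (B.apply_symm_apply (A y)).symm
    have hr := (hss.restrict hinv).iSup_eigenspace_eq_top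
    have hle : ⨆ ν, Module.End.eigenspace (f.restrict hinv) ν ≤
        Module.End.eigenspace (f.restrict hinv) μ := by
      refine iSup_le fun ν => ?_
      rcases eq_or_ne ν μ with rfl | hν
      · exact le_rfl
      intro y hy
      have hy1 : A y.1 = ν • y.1 := congrArg Subtype.val (Module.End.mem_eigenspace_iff.1 hy)
      have hy2 := inner_eq_zero_of_unitary_eigenvectors A hν.symm ((hp y).1 y.2) hy1
      -- `y` and `B⁻¹ y` are orthogonal, so by Pythagoras `B` would move `B⁻¹ y` by at least its own
      -- norm.
      suffices h0 : B⁻¹ y.1 = 0 by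
        have h1 : y = 0 := Subtype.ext ((B⁻¹).injective (h0.trans (map_zero B⁻¹).symm))
        rw [h1]; exact zero_mem _
      by_contra h0
      have h1 := hB _ h0
      have h2 : B (B⁻¹ y.1) = y.1 := B.apply_symm_apply y.1
      have h3 : ‖B⁻¹ y.1 - y.1‖ * ‖B⁻¹ y.1 - y.1‖ =
          ‖B⁻¹ y.1‖ * ‖B⁻¹ y.1‖ + ‖y.1‖ * ‖y.1‖ := by
        rw [sub_eq_add_neg, norm_add_sq_eq_norm_sq_add_norm_sq_of_inner_eq_zero (𝕜 := ℂ), norm_neg]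
        rw [inner_neg_right, hy2, neg_zero]
      rw [h2, norm_sub_rev] at h1
      nlinarith [norm_nonneg (B⁻¹ y.1), norm_nonneg y.1, norm_nonneg (B⁻¹ y.1 - y.1)]
    rw [hr] at hle
    have hBx : B x ∈ p := (hp _).2 (by
      have : B⁻¹ (B x) = x := B.symm_apply_apply x
      rw [this, hx])
    exact congrArg Subtype.val
      (Module.End.mem_eigenspace_iff.1 (hle (Submodule.mem_top (x := (⟨B x, hBx⟩ : p)))))
  have hle : ⨆ μ, f.eigenspace μ ≤ LinearMap.eqLocus (A * B).toLinearEquiv.toLinearMap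
      (B * A).toLinearEquiv.toLinearMap := by
    refine iSup_le fun μ x hx => ?_
    have hx' : A x = μ • x := Module.End.mem_eigenspace_iff.1 hx
    change A (B x) = B (A x)
    rw [key μ x hx', hx', map_smul]
  rw [htop] at hle
  exact LinearIsometryEquiv.ext fun x => hle (Submodule.mem_top (x := x))

end Jordan

/-- This rests on `g h - h g = (g - 1)(h - 1) - (h - 1)(g - 1)`. -/
theorem norm_unitary_commutator_sub_one_le {R : Type*} [NormedRing R] [StarRing R] [CStarRing R]
    (g h : unitary R) :
    ‖((⁅g, h⁆ : unitary R) : R) - 1‖ ≤ 2 * ‖(g : R) - 1‖ * ‖(h : R) - 1‖ := by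
  have h1 : ((⁅g, h⁆ : unitary R) : R) - 1 =
      (((g : R) - 1) * (h - 1) - (h - 1) * (g - 1)) * (g⁻¹ * h⁻¹ : unitary R) := by
    have h2 : (g : R) * h * (g⁻¹ * h⁻¹ : unitary R) = (⁅g, h⁆ : unitary R) := by
      rw [← Submonoid.coe_mul, ← Submonoid.coe_mul, commutatorElement_def, mul_assoc (g * h)]
    have h3 : (h : R) * g * (g⁻¹ * h⁻¹ : unitary R) = 1 := by
      rw [← Submonoid.coe_mul, ← Submonoid.coe_mul]
      simp [mul_assoc]
    rw [← h2]
    conv_lhs => rw [← h3]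
    rw [← sub_mul]
    congr 1
    noncomm_ring
  rw [h1, CStarRing.norm_mul_coe_unitary]
  refine (norm_sub_le _ _).trans ?_
  have h4 := norm_mul_le ((g : R) - 1) (h - 1)
  have h5 := norm_mul_le ((h : R) - 1) (g - 1)
  linarith

theorem norm_unitary_inv_mul_sub_one {R : Type*} [NormedRing R] [StarRing R] [CStarRing R]
    (g h : unitary R) : ‖((g⁻¹ * h : unitary R) : R) - 1‖ = ‖(h : R) - g‖ := by
  rw [← CStarRing.norm_coe_unitary_mul g, mul_sub, ← Submonoid.coe_mul]
  simp

section Jordan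

variable {E : Type*} [NormedAddCommGroup E] [InnerProductSpace ℂ E] [FiniteDimensional ℂ E]

/-- Among the counterexamples `h` take one closest to `1`. Then `⁅g, h⁆` is strictly closer, so it
commutes with `g`; hence so does `h g h⁻¹`, and Frobenius' lemma applies. -/
theorem commute_of_norm_sub_one_lt {N : Type*} [Group N] [Finite N]
    {τ : N →* unitary (E →L[ℂ] E)} (hτ : Function.Injective τ) {g h : N}
    (hg : ‖(τ g : E →L[ℂ] E) - 1‖ < 1 / 2) (hh : ‖(τ h : E →L[ℂ] E) - 1‖ < 1 / 2) :
    Commute g h := by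
  by_contra hgh
  obtain ⟨h, ⟨hh, hgh⟩, hmin⟩ := Set.exists_min_image
    {h | ‖(τ h : E →L[ℂ] E) - 1‖ < 1 / 2 ∧ ¬ Commute g h} (fun h => ‖(τ h : E →L[ℂ] E) - 1‖)
    (Set.toFinite _) ⟨h, hh, hgh⟩
  have hpos : 0 < ‖(τ h : E →L[ℂ] E) - 1‖ := by
    rw [norm_pos_iff, sub_ne_zero]
    intro h1
    have : h = 1 := hτ (Subtype.ext (by rw [h1, map_one]; rfl))
    exact hgh (this ▸ Commute.one_right g)
  have hlt : ‖(τ ⁅g, h⁆ : E →L[ℂ] E) - 1‖ < ‖(τ h : E →L[ℂ] E) - 1‖ := by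
    rw [map_commutatorElement]
    refine (norm_unitary_commutator_sub_one_le _ _).trans_lt ?_
    nlinarith
  have hcomm : Commute g ⁅g, h⁆ := by
    by_contra hc
    exact absurd (hmin ⁅g, h⁆ ⟨hlt.trans hh, hc⟩) (not_le.2 hlt)
  have hconj : Commute g (h * g * h⁻¹) := by
    have h1 : h * g * h⁻¹ = (g⁻¹ * ⁅g, h⁆)⁻¹ := by rw [commutatorElement_def]; group
    rw [h1]
    exact (((Commute.refl g).inv_right).mul_right hcomm).inv_right
  let σ : N →* (E ≃ₗᵢ[ℂ] E) := Unitary.linearIsometryEquiv.toMonoidHom.comp τ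
  have hσ : Function.Injective σ := Unitary.linearIsometryEquiv.injective.comp hτ
  have hB : ∀ x, x ≠ 0 → ‖σ h x - x‖ < ‖x‖ := fun x hx => by
    have h1 : ‖((τ h : E →L[ℂ] E) - 1) x‖ ≤ ‖(τ h : E →L[ℂ] E) - 1‖ * ‖x‖ :=
      ContinuousLinearMap.le_opNorm _ x
    have h2 : σ h x - x = ((τ h : E →L[ℂ] E) - 1) x := rfl
    rw [h2]
    have h3 := norm_pos_iff.2 hx
    nlinarith
  have h1 := commute_of_commute_conj (σ g) (σ h) (Nat.card_pos (α := N))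
    (by rw [← map_pow, pow_card_eq_one', map_one]) hB (by
      rw [← map_mul, ← map_inv, ← map_mul]; exact hconj.map σ)
  exact hgh (hσ (by rw [map_mul, map_mul, h1.eq]))

theorem exists_abelian_subgroup_of_unitary (E : Type*) [NormedAddCommGroup E]
    [InnerProductSpace ℂ E] [FiniteDimensional ℂ E] :
    ∃ J : ℕ, ∀ (N : Type*) [Group N] [Finite N] (τ : N →* unitary (E →L[ℂ] E)),
      Function.Injective τ → ∃ A : Subgroup N, (∀ a ∈ A, ∀ b ∈ A, Commute a b) ∧ A.index ≤ J := by
  have : ProperSpace (E →L[ℂ] E) := FiniteDimensional.proper ℂ _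
  -- Two unitaries in one ball of radius `1 / 4` differ by a factor within `1 / 2` of the identity,
  -- so the number of balls bounds the index.
  obtain ⟨t, -, ht, hcover⟩ := finite_cover_balls_of_compact
    (isCompact_closedBall (0 : E →L[ℂ] E) 1) (e := 1 / 4) (by norm_num)
  have := ht.to_subtype
  refine ⟨Nat.card t, fun N _ _ τ hτ => ?_⟩
  let A := Subgroup.closure {g | ‖(τ g : E →L[ℂ] E) - 1‖ < 1 / 2}
  have hA : ∀ a ∈ A, ∀ b ∈ A, Commute a b := by
    have h1 : IsMulCommutative A := Subgroup.isMulCommutative_closure fun g hg h hh =>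
      (commute_of_norm_sub_one_lt hτ hg hh).eq
    intro a ha b hb
    exact congrArg Subtype.val (mul_comm' (⟨a, ha⟩ : A) ⟨b, hb⟩)
  refine ⟨A, hA, ?_⟩
  have hball : ∀ g : N, ∃ c : t, ‖(τ g : E →L[ℂ] E) - c‖ < 1 / 4 := fun g => by
    have h1 : (τ g : E →L[ℂ] E) ∈ Metric.closedBall (0 : E →L[ℂ] E) 1 := by
      rw [mem_closedBall_zero_iff]
      rcases subsingleton_or_nontrivial (E →L[ℂ] E) with h | h
      · rw [Subsingleton.elim (τ g : E →L[ℂ] E) 0, norm_zero]; exact zero_le_one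
      · exact (CStarRing.norm_coe_unitary _).le
    obtain ⟨c, hc, hgc⟩ := Set.mem_iUnion₂.1 (hcover h1)
    exact ⟨⟨c, hc⟩, mem_ball_iff_norm.1 hgc⟩
  choose c hc using hball
  have hinj : Function.Injective fun q : N ⧸ A => c q.out := by
    intro q r hqr
    rw [← QuotientGroup.out_eq' q, ← QuotientGroup.out_eq' r, QuotientGroup.eq]
    refine Subgroup.subset_closure ?_
    rw [Set.mem_ofPred_eq, map_mul, map_inv, norm_unitary_inv_mul_sub_one]
    have h1 := hc q.out
    have h2 := hc r.out
    rw [show c q.out = c r.out from hqr, norm_sub_rev] at h1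
    have h3 := norm_sub_le_norm_sub_add_norm_sub (τ r.out : E →L[ℂ] E) (c r.out)  (τ q.out)
    linarith
  exact Nat.card_le_card_of_injective _ hinj

end Jordan

open scoped MatrixOrder Matrix.Norms.L2Operator in
/-- **Jordan's theorem** on finite linear groups in characteristic zero. -/
theorem exists_abelian_subgroup_of_linear (n : ℕ) :
    ∃ J : ℕ, ∀ (K : Type*) [Field K] [CharZero K] (N : Type*) [Group N] [Finite N]
      (ρ : N →* Matrix (Fin n) (Fin n) K), Function.Injective ρ →
      ∃ A : Subgroup N, (∀ a ∈ A, ∀ b ∈ A, Commute a b) ∧ A.index ≤ J := by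
  obtain ⟨J, hJ⟩ := exists_abelian_subgroup_of_unitary (EuclideanSpace ℂ (Fin n))
  refine ⟨J, fun K _ _ N _ _ ρ hρ => ?_⟩
  obtain ⟨ρ', hρ'⟩ := exists_injective_complex_representation ρ hρ
  obtain ⟨τ, hτ⟩ := exists_unitary_representation ρ' hρ'
  let e := Matrix.toEuclideanCLM (n := Fin n) (𝕜 := ℂ)
  let φ : unitary (Matrix (Fin n) (Fin n) ℂ) →*
      unitary (EuclideanSpace ℂ (Fin n) →L[ℂ] EuclideanSpace ℂ (Fin n)) :=
    (Unitary.map { toFun := e, map_one' := map_one e, map_mul' := map_mul e,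
                   map_star' := map_star e }).toMonoidHom
  refine hJ N (φ.comp τ) fun g h hgh => hτ (Subtype.ext ((EquivLike.injective e) ?_))
  exact congrArg Subtype.val hgh

/-! ### Assembly of the main theorem. -/

theorem mainTheorem3 (c n m : ℕ) (hc : 0 < c) (hn : 0 < n) (hm : 0 < m) :
    ∃ C : ℕ, 0 < C ∧
      ∀ (K : Type*) [Field K] [CharZero K], ContainsAllRootsOfUnity K →
      ∀ (G : Subgroup (SemilinearGroup n K)) [Finite G],
        EverySubgroupGeneratedBy G m →
        IsNilpotentOfClassAtMost (G.map (SemilinearGroup.toAut n K)) c →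
        FixesRootsOfUnity (G.map (SemilinearGroup.toAut n K)) →
        ∃ H : Subgroup G, IsNilpotentOfClassAtMost H (c + 1) ∧ H.index ≤ C := by
  obtain ⟨J, hJ⟩ := exists_abelian_subgroup_of_linear n
  -- The inner `homKernelBound J m` bounds the index of `A` in `N`.
  refine ⟨homKernelBound (homKernelBound J m) m ^ 2 * n ^ n,
    Nat.mul_pos (pow_pos (homKernelBound_pos _ _) _) (pow_pos hn n), ?_⟩
  intro K _ _ hK G _ hGm hΓ hroots
  let π : G →* RingAut K := (SemilinearGroup.toAut n K).comp G.subtype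
  let N := π.ker
  have hright : ∀ g ∈ N, g.1.right = 1 := fun g hg => hg
  let ρ : N →* Matrix (Fin n) (Fin n) K :=
    { toFun g := (g.1.1.left : Matrix (Fin n) (Fin n) K)
      map_one' := rfl
      map_mul' g h := by
        have h1 := hright g g.2
        simp [h1] }
  have hρ : Function.Injective ρ := fun g h hgh => Subtype.ext (Subtype.ext
    (SemidirectProduct.ext (Units.ext hgh) ((hright g g.2).trans (hright h h.2).symm)))
  obtain ⟨A₀, hA₀, hA₀J⟩ := hJ K N ρ hρ
  let A₁ := homKernel N (Perm (Fin J))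
  have hA₁ : A₁ ≤ A₀ := homKernel_perm_le_of_index_le A₀ hA₀J
  let A := A₁.map N.subtype
  -- `A₁` is characteristic in the normal subgroup `N`.
  have hAnormal : A.Normal := inferInstance
  refine (exists_subgroup_of_abelian_normal (J := homKernelBound J m) (B := n ^ n) hc hGm A N
    ?_ ?_ ?_).imp fun H hH => ⟨isNilpotentOfClassAtMost_subgroup_iff.2 hH.1, hH.2⟩
  · have h1 : A.relIndex N = A₁.index := by
      rw [Subgroup.relIndex, Subgroup.subgroupOf,
        Subgroup.comap_map_eq_self_of_injective N.subtype_injective]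
    rw [h1]
    exact index_homKernel_perm_le (hGm.subgroup N) J
  · refine index_centralizer_le_of_fixesRootsOfUnity hn hK G ?_ A ?_ ?_
    · exact fun g hg ζ k hk hζ => hroots g.right ⟨g, hg, rfl⟩ ζ k hk hζ
    · rintro _ ⟨a, ha, rfl⟩ _ ⟨b, hb, rfl⟩
      exact (hA₀ a (hA₁ ha) b (hA₁ hb)).map N.subtype
    · rintro _ ⟨a, -, rfl⟩
      exact hright a a.2
  · rw [← Subgroup.map_eq_bot_iff, Subgroup.map_lowerCentralSeries]
    rw [isNilpotentOfClassAtMost_subgroup_iff] at hΓ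
    rw [← hΓ, ← MonoidHom.range_eq_map, MonoidHom.range_comp, Subgroup.range_subtype]
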